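/- Let $\mathbb X$ be a measurable space. A q-metric on a set $\Upsilon$ is a function $d:\Upsilon\times\Upsilon\to[0,\infty)$ such that $d(a,b)=0$ if and only if $a=b$, and $d(a,b)\le d(a,e)+d(e,b)$ for all $a,b,e\in\Upsilon$. Let $d_b$ be a measurable q-metric on $\mathbb X$, and let $c>0$, $1\le p<\infty$, $\gamma>0$, $\rho\in(0,1)$ and $T\in\mathbb N$. A trajectory is a pair $X=(\omega,x^{1:\nu})$ with integers $1\le\omega\le T$, $1\le\nu\le T-\omega+1$ and $x^{1:\nu}\in\mathbb X^\nu$; its set of objects at time $k\in\{1,\dots,T\}$ is $\{x^{k-\omega+1}\}$ if $\omega\le k\le\omega+\nu-1$ and $\emptyset$ otherwise. For sets $\mathbf x,\mathbf y\subseteq\mathbb X$ with at most one element put $$d_p^{(c,\rho)}(\mathbf x,\mathbf y)=\begin{cases}\min(c,d_b(x,y)) & \mathbf x=\{x\},\ \mathbf y=\{y\},\\ \rho^{1/p}c & \mathbf x=\emptyset,\ \mathbf y=\{y\},\\ (1-\rho)^{1/p}c & \mathbf x=\{x\},\ \mathbf y=\emptyset,\\ 0 & \mathbf x=\mathbf y=\emptyset.\end{cases}$$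 Let $\mathbf X=\{X_1,\dots,X_m\}$ and $\mathbf Y=\{Y_1,\dots,Y_n\}$ be finite sets of (distinct) trajectories, let $\mathbf x_i^k$, $\mathbf y_j^k$ be the sets of objects of $X_i$, $Y_j$ at time $k$, and let $n_{\mathbf X}^k=\sum_i|\mathbf x_i^k|$, $n_{\mathbf Y}^k=\sum_j|\mathbf y_j^k|$. Let $\Pi_{\mathbf X,\mathbf Y}$ be the set of vectors $\pi\in\{0,\dots,n\}^m$ such that $\pi_i=\pi_{i'}>0$ implies $i=i'$. For $\pi\in\Pi_{\mathbf X,\mathbf Y}$ let $\theta^k(\pi)$ be the set of pairs $(i,\pi_i)$ with $\pi_i>0$, $|\mathbf x_i^k|=|\mathbf y_{\pi_i}^k|=1$ and $d_p^{(c,\rho)}(\mathbf x_i^k,\mathbf y_{\pi_i}^k)<c$. The T-GOSPA q-metric is $$d(\mathbf X,\mathbf Y)=\min_{\pi^1,\dots,\pi^T\in\Pi_{\mathbf X,\mathbf Y}}\Big(\sum_{k=1}^T\Big[\sum_{(i,j)\in\theta^k(\pi^k)}d_p^{(c,\rho)}(\mathbf x_i^k,\mathbf y_j^k)^p+\rho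 c^p\big(n_{\mathbf Y}^k-|\theta^k(\pi^k)|\big)+(1-\rho)c^p\big(n_{\mathbf X}^k-|\theta^k(\pi^k)|\big)\Big]+\gamma^p\sum_{k=1}^{T-1}\sum_{i=1}^m s(\pi_i^k,\pi_i^{k+1})\Big)^{1/p},$$ where $s(a,b)=0$ if $a=b$, $s(a,b)=1$ if $a\ne b$ are both nonzero, and $s(a,b)=\tfrac12$ otherwise. Let $(\Omega,\mathcal F,\mathbb P)$ be a probability space. A random finite set (RFS) of trajectories is a measurable map from $\Omega$ to the finite sets of trajectories, where the space of trajectories is the disjoint union over $(\omega,\nu)$ of the spaces $\mathbb X^\nu$, and a family of finite sets is measurable if for every $n$ the tuples $(X_1,\dots,X_n)$ of pairwise distinct trajectories with $\{X_1,\dots,X_n\}$ in the family form a measurable set of such tuples. RFSs that are almost surely equal are identified. Then, for every real $p'$ with $1\le p'<\infty$, on the space of RFSs of trajectories $\mathbf X$ on $(\Omega,\mathcal F,\mathbb P)$ with $\mathbb E\big[|\mathbf X|^{p'/p}\big]<\infty$, the expectation $\mathbb E\big[d(\mathbf X,\mathbf Y)^{p'}\big]$ is finite for all $\mathbf X,\mathbf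 Y$, and $$(\mathbf X,\mathbf Y)\mapsto\Big(\mathbb E\big[d(\mathbf X,\mathbf Y)^{p'}\big]\Big)^{1/p'}$$ is a q-metric. -/

import Mathlib

open MeasureTheory

noncomputable section

/-- A quasi-metric (q-metric): a non-negative real function satisfying the identity property and
the triangle inequality, not necessarily symmetric. -/
structure IsQMetric {S : Type*} (d : S → S → ℝ) : Prop where
  nonneg : ∀ x y, 0 ≤ d x y
  eq_zero_iff : ∀ x y, d x y = 0 ↔ x = y
  triangle : ∀ x y z, d x y ≤ d x z + d z y

/-- A trajectory in the time window `1, …, T`: a start time `ω` and a duration `ν` with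
`1 ≤ ω ≤ T` and `1 ≤ ν ≤ T - ω + 1`, and a sequence of `ν` states. It carries the σ-algebra
of the disjoint union over `(ω, ν)` of the product spaces `E ^ ν`. -/
abbrev Trajectory (T : ℕ) (E : Type*) : Type _ :=
  Σ s : {s : ℕ × ℕ // 1 ≤ s.1 ∧ s.1 ≤ T ∧ 1 ≤ s.2 ∧ s.1 + s.2 ≤ T + 1}, Fin s.1.2 → E

namespace Trajectory

variable {T : ℕ} {E : Type*}

/-- Start time step. -/
def start (X : Trajectory T E) : ℕ := X.1.1.1

/-- Duration. -/
def duration (X : Trajectory T E) : ℕ := X.1.1.2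

/-- The set of objects of the trajectory at time step `k`; it has at most one element and is
represented by an `Option` (`none` is the empty set, `some x` is `{x}`). -/
def stateAt (X : Trajectory T E) (k : ℕ) : Option E :=
  if h : X.start ≤ k ∧ k < X.start + X.duration then
    some (X.2 ⟨k - X.start, by have := h.1; have := h.2; unfold duration at *; omega⟩)
  else none

end Trajectory

/-- The GOSPA q-metric between sets of objects with at most one element. -/
def gospaOne {E : Type*} (db : E → E → ℝ) (c p ρ : ℝ) : Option E → Option E → ℝ
  | some x, some y => min c (db x y)
  | none, some _ => ρ ^ (1 / p) * c
  | some _, none => (1 - ρ) ^ (1 / p) * c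
  | none, none => 0

section TGOSPA

variable {T : ℕ} {E : Type*}

/-- Assignment vectors between the trajectories in `X` and those in `Y`. The vectors are indexed
by the elements of `X` themselves; the value `none` means unassigned, and no trajectory in `Y`
is assigned to two different trajectories in `X`. -/
def AssignmentVector (X Y : Finset (Trajectory T E)) : Type _ :=
  {π : X → Option Y // ∀ i i' : X, ∀ j : Y, π i = some j → π i' = some j → i = i'}

/-- The number of objects of `X` present at time step `k`. -/
def numPresent (X : Finset (Trajectory T E)) (k : ℕ) : ℕ :=
  ∑ i ∈ X, if (i.stateAt k).isSome then 1 else 0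

open Classical in
/-- The object-level assignment set at time step `k` determined by an assignment vector. -/
def objectAssignment (db : E → E → ℝ) (c p ρ : ℝ) (X Y : Finset (Trajectory T E)) (k : ℕ)
    (π : AssignmentVector X Y) : Finset (X × Y) :=
  Finset.univ.filter fun ij : X × Y =>
    π.1 ij.1 = some ij.2 ∧ (ij.1.1.stateAt k).isSome ∧ (ij.2.1.stateAt k).isSome ∧
      gospaOne db c p ρ (ij.1.1.stateAt k) (ij.2.1.stateAt k) < c

/-- Localisation, false-object and missed-object costs (to the `p`-th power) at time step `k`. -/
def stepCost (db : E → E → ℝ) (c p ρ : ℝ) (X Y : Finset (Trajectory T E)) (k : ℕ)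
    (π : AssignmentVector X Y) : ℝ :=
  (∑ ij ∈ objectAssignment db c p ρ X Y k π,
      gospaOne db c p ρ (ij.1.1.stateAt k) (ij.2.1.stateAt k) ^ p)
    + ρ * c ^ p * ((numPresent Y k : ℝ) - ((objectAssignment db c p ρ X Y k π).card : ℝ))
    + (1 - ρ) * c ^ p * ((numPresent X k : ℝ) - ((objectAssignment db c p ρ X Y k π).card : ℝ))

open Classical in
/-- The number of track switches (a half-switch counts `1 / 2`) contributed by one entry of two
consecutive assignment vectors. -/
def switchCount {α : Type*} (a b : Option α) : ℝ :=
  if a = b then 0 else if a ≠ none ∧ b ≠ none then 1 else 1 / 2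

/-- The track switch penalty (to the `p`-th power) between two consecutive time steps. -/
def switchCost (γ p : ℝ) {X Y : Finset (Trajectory T E)} (π π' : AssignmentVector X Y) : ℝ :=
  γ ^ p * ∑ i : X, switchCount (π.1 i) (π'.1 i)

/-- The cost of a sequence of assignment vectors (to the `p`-th power). The index `k : Fin T`
stands for the time step `k + 1`, so that time runs over `1, …, T`. -/
def sequenceCost (db : E → E → ℝ) (c p γ ρ : ℝ) (X Y : Finset (Trajectory T E))
    (π : Fin T → AssignmentVector X Y) : ℝ :=
  (∑ k : Fin T, stepCost db c p ρ X Y ((k : ℕ) + 1) (π k))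
    + ∑ k : Fin (T - 1),
        switchCost γ p (π ⟨(k : ℕ), by omega⟩) (π ⟨(k : ℕ) + 1, by omega⟩)

/-- The T-GOSPA q-metric between two finite sets of trajectories. The infimum is over a finite
nonempty set of sequences of assignment vectors, hence is a minimum. -/
def tgospa (db : E → E → ℝ) (c p γ ρ : ℝ) (X Y : Finset (Trajectory T E)) : ℝ :=
  ⨅ π : Fin T → AssignmentVector X Y, sequenceCost db c p γ ρ X Y π ^ (1 / p)

instance (X Y : Finset (Trajectory T E)) : Finite (AssignmentVector X Y) :=
  Subtype.finite

instance (X Y : Finset (Trajectory T E)) : Nonempty (AssignmentVector X Y) :=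
  ⟨⟨fun _ => none, fun _ _ _ h => by simp at h⟩⟩

end TGOSPA

/-- The σ-algebra on the finite subsets of a measurable space `F`: a family of finite sets is
measurable if, for every `n`, the family of the tuples `(x₁, …, xₙ)` of pairwise distinct points
with `{x₁, …, xₙ}` in it is measurable in the space of such tuples. It makes every counting map
`s ↦ |s ∩ B|`, with `B` measurable, measurable. (The instance on `Finset` in Mathlib is generated
by the events `a ∈ s` alone, which is too coarse for uncountable `F`.) -/
abbrev finiteSetSigma (F : Type*) [MeasurableSpace F] : MeasurableSpace (Finset F) :=
  ⨅ n : ℕ, MeasurableSpace.map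
    (fun x : {x : Fin n → F // Function.Injective x} => Finset.univ.map ⟨x.1, x.2⟩)
    inferInstance

section RFS

variable {Ω : Type*} [MeasurableSpace Ω] (P : Measure Ω) (T : ℕ) (E : Type*) [MeasurableSpace E]

/-- Random finite sets of trajectories on the probability space `(Ω, P)` with finite cardinality
moment of order `r`. -/
structure TrajectoryRFS (r : ℝ) where
  toFun : Ω → Finset (Trajectory T E)
  measurable : Measurable[_, finiteSetSigma (Trajectory T E)] toFun
  moment : Integrable (fun ω => ((toFun ω).card : ℝ) ^ r) P

/-- As usual for random variables, almost surely equal random finite sets are identified. -/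
instance TrajectoryRFS.setoid (r : ℝ) : Setoid (TrajectoryRFS P T E r) where
  r X Y := X.toFun =ᵐ[P] Y.toFun
  iseqv := ⟨fun _ => Filter.EventuallyEq.rfl, fun h => h.symm, fun h h' => h.trans h'⟩

/-- The space of random finite sets of trajectories with finite cardinality moment of order `r`,
modulo almost sure equality. -/
def RFSSpace (r : ℝ) : Type _ := Quotient (TrajectoryRFS.setoid P T E r)

variable {P T E}

/-- `(E[d(X, Y)^p'])^(1/p')` for random finite sets `X`, `Y`, with `d` the T-GOSPA q-metric. -/
def rfsDist (db : E → E → ℝ) (c p γ ρ p' : ℝ) {r : ℝ} (X Y : TrajectoryRFS P T E r) : ℝ :=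
  (∫ ω, tgospa db c p γ ρ (X.toFun ω) (Y.toFun ω) ^ p' ∂P) ^ (1 / p')

/-- `rfsDist` on the space of random finite sets modulo almost sure equality. -/
def rfsQDist (db : E → E → ℝ) (c p γ ρ p' : ℝ) {r : ℝ} : RFSSpace P T E r → RFSSpace P T E r → ℝ :=
  Quotient.lift₂ (rfsDist db c p γ ρ p') fun X Y X' Y' (hX : X.toFun =ᵐ[P] X'.toFun)
      (hY : Y.toFun =ᵐ[P] Y'.toFun) => by
    unfold rfsDist
    congr 1
    refine integral_congr_ae ?_
    filter_upwards [hX, hY] with ω h h'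
    rw [h, h']

end RFS

end

/-! The cut-off in the definition of the assignment set is harmless. A pair assigned to each other
but excluded from that set (distance `c`, or an object missing) costs exactly what its objects cost
unassigned, since `ρ * c ^ p + (1 - ρ) * c ^ p = c ^ p`. Hence T-GOSPA is a minimum, over sequences
of partial matchings (`PEquiv`), of the `p`-th powers of `gospaOne` summed over matched pairs and
unmatched points, plus switches (`tgospa_eq_iInf_familyCost`).

For the triangle inequality, compose optimal matchings through the middle set. The composite cost is
a sum over one common index set on which the base triangle inequality holds termwise
(`pairingCost_trans`). Switches of a composite are at most the switches of its factors
(`sum_switchCount_trans_le`), and Minkowski's inequality in finite dimension concludes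
(`familyCost_trans_le`). If the distance vanishes, an optimal sequence is a constant matching of
trajectories with equal states at all times, so the sets agree (`tgospa_eq_zero_iff`).

For random sets, the empty matching bounds the `p`-th power by a multiple of the sum of the
cardinalities, which gives integrability (`tgospa_le_card`). Joint measurability comes from
averaging over enumerations (`measurable_comp_finiteSetSigma`). Minkowski's inequality in `L^{p'}`
gives the triangle inequality, and a zero integral of a non-negative function forces almost sure
equality. -/

noncomputable section

/-! ### Costs of partial matchings and of their composites -/

section Pairing

variable {ι ζ κ : Type*} [Fintype ι] [Fintype ζ] [Fintype κ]

open Classical in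
/-- The cost of a partial matching: `Φ (some i) (some j)` for a matched pair, `Φ (some i) none`
and `Φ none (some j)` for unmatched points. -/
def pairingCost (Φ : Option ι → Option κ → ℝ) (f : ι ≃. κ) : ℝ :=
  (∑ i, ∑ j, if f i = some j then Φ (some i) (some j) else 0)
    + (∑ i, if f i = none then Φ (some i) none else 0)
    + ∑ j, if f.symm j = none then Φ none (some j) else 0

open Classical in
lemma pairingCost_eq_sum_left (Φ : Option ι → Option κ → ℝ) (f : ι ≃. κ) :
    pairingCost Φ f = (∑ i, Φ (some i) (f i))
      + ∑ j, if f.symm j = none then Φ none (some j) else 0 := by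
  unfold pairingCost
  rw [← Finset.sum_add_distrib]
  congr 1
  refine Finset.sum_congr rfl fun i _ => ?_
  cases h : f i <;> simp

open Classical in
lemma pairingCost_eq_sum_right (Φ : Option ι → Option κ → ℝ) (f : ι ≃. κ) :
    pairingCost Φ f = (∑ i, if f i = none then Φ (some i) none else 0)
      + ∑ j, Φ (f.symm j) (some j) := by
  unfold pairingCost
  rw [Finset.sum_comm, add_comm (∑ j, ∑ i, _), add_assoc, ← Finset.sum_add_distrib]
  congr 1
  refine Finset.sum_congr rfl fun j _ => ?_
  have key : ∀ i, f i = some j ↔ f.symm j = some i := fun i => (f.eq_some_iff).symm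
  simp only [key]
  cases h : f.symm j <;> simp

-- Double counting through the middle set: an `i` matched by `f` is recorded at its partner `z`, a
-- `j` matched by `g` at its partner, and a `z` matched on neither side contributes `Φ none none =
-- 0`.
open Classical in
lemma pairingCost_trans (Φ : Option ι → Option κ → ℝ) (hΦ : Φ none none = 0)
    (f : ι ≃. ζ) (g : ζ ≃. κ) :
    pairingCost Φ (f.trans g) = (∑ i, if f i = none then Φ (some i) none else 0)
      + (∑ z, Φ (f.symm z) (g z)) + ∑ j, if g.symm j = none then Φ none (some j) else 0 := by
  -- The left and right expansions of two auxiliary costs are compared: `Φ` with `g` applied to its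
  -- second argument, and `Φ none` restricted to points without `f`-partner. The sum over `z`
  -- without `f`-partner occurs in both comparisons and cancels.
  have h1 := pairingCost_eq_sum_left (fun x (z : Option ζ) => Φ x (z.bind g)) f
  have h2 := pairingCost_eq_sum_right (fun x (z : Option ζ) => Φ x (z.bind g)) f
  have h3 := pairingCost_eq_sum_left
    (fun (z : Option ζ) y => if z.bind f.symm = none then Φ none y else 0) g
  have h4 := pairingCost_eq_sum_right
    (fun (z : Option ζ) y => if z.bind f.symm = none then Φ none y else 0) g
  rw [pairingCost_eq_sum_left]
  simp only [Option.bind_some, Option.bind_none, hΦ, ite_self, Finset.sum_const_zero, zero_add,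
    if_true] at h1 h2 h3 h4
  have e1 : ∀ i, (f.trans g) i = (f i).bind g := fun i => rfl
  have e2 : ∀ j, (f.trans g).symm j = (g.symm j).bind f.symm := fun j => rfl
  simp only [e1, e2]
  linarith

end Pairing

/-! ### Subadditivity of track switches under composition -/

section Switching

lemma switchCount_nonneg {α : Type*} (a b : Option α) : 0 ≤ switchCount a b := by
  unfold switchCount
  split_ifs <;> norm_num

lemma switchCount_self {α : Type*} (a : Option α) : switchCount a a = 0 := by
  simp [switchCount]

lemma switchCount_eq_zero {α : Type*} {a b : Option α} (h : switchCount a b = 0) : a = b := by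
  by_contra hab
  unfold switchCount at h
  rw [if_neg hab] at h
  split_ifs at h <;> norm_num at h

lemma switchCount_map {α β : Type*} {e : α → β} (he : Function.Injective e) (a b : Option α) :
    switchCount (a.map e) (b.map e) = switchCount a b := by
  by_cases h : a = b
  · rw [h, switchCount_self, switchCount_self]
  · have h' : a.map e ≠ b.map e := fun h' => h (Option.map_injective he h')
    simp [switchCount, h, h']

-- If `a ≠ a'`, the first factor pays for everything: a full switch is already the maximum, and when
-- one of them is `none` so is the corresponding composite, which leaves at most a half-switch. If
-- `a = a' = some z`, only the switch of `g` at `z` remains.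
open Classical in
lemma switchCount_bind_le {ζ κ : Type*} [Fintype ζ] (a a' : Option ζ) (g g' : ζ → Option κ) :
    switchCount (a.bind g) (a'.bind g') ≤ switchCount a a'
      + ∑ z, if a = some z ∧ a' = some z then switchCount (g z) (g' z) else 0 := by
  have hnn : 0 ≤ ∑ z, if a = some z ∧ a' = some z then switchCount (g z) (g' z) else 0 :=
    Finset.sum_nonneg fun z _ => by
      split_ifs
      · exact switchCount_nonneg _ _
      · exact le_rfl
  by_cases h : a = a'
  · subst h
    cases a <;> simp [switchCount_self]
  · refine le_trans ?_ (le_add_of_nonneg_right hnn)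
    rcases a with _ | a <;> rcases a' with _ | a'
    · exact absurd rfl h
    · unfold switchCount
      simp only [Option.bind_none]
      split_ifs <;> simp_all
    · unfold switchCount
      simp only [Option.bind_none]
      split_ifs <;> simp_all
    · have : switchCount (some a) (some a') = 1 := by simp [switchCount, h]
      rw [this]
      unfold switchCount
      split_ifs <;> norm_num

lemma sum_switchCount_trans_le {ι ζ κ : Type*} [Fintype ι] [Fintype ζ]
    (f f' : ι ≃. ζ) (g g' : ζ ≃. κ) :
    ∑ i, switchCount ((f.trans g) i) ((f'.trans g') i)
      ≤ (∑ i, switchCount (f i) (f' i)) + ∑ z, switchCount (g z) (g' z) := by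
  classical
  calc ∑ i, switchCount ((f.trans g) i) ((f'.trans g') i)
      ≤ ∑ i, (switchCount (f i) (f' i)
        + ∑ z, if f i = some z ∧ f' i = some z then switchCount (g z) (g' z) else 0) :=
        Finset.sum_le_sum fun i _ => switchCount_bind_le (f i) (f' i) g g'
    _ ≤ _ := by
      rw [Finset.sum_add_distrib, Finset.sum_comm]
      -- At most one `i` is matched to a given `z`, so each switch of `g` is charged at most once.
      refine add_le_add_right (Finset.sum_le_sum fun z _ => ?_) _
      have key : ∀ i, f i = some z ↔ f.symm z = some i := fun i => (f.eq_some_iff).symm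
      simp only [key]
      cases h : f.symm z with
      | none => simpa using switchCount_nonneg _ _
      | some i =>
        rw [Finset.sum_eq_single i]
        · split_ifs
          · exact le_rfl
          · exact switchCount_nonneg _ _
        · intro b _ hb
          rw [if_neg]
          rintro ⟨h1, -⟩
          exact hb (Option.some.inj h1).symm
        · simp

end Switching

/-! ### The base q-metric on sets with at most one element -/

section Gospa

variable {E : Type*} {db : E → E → ℝ} {c p ρ : ℝ}

@[simp] lemma gospaOne_none_none : gospaOne db c p ρ none none = 0 := rfl

lemma gospaOne_nonneg (hdb : IsQMetric db) (hc : 0 < c) (hρ : 0 < ρ) (hρ' : ρ < 1)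
    (a b : Option E) : 0 ≤ gospaOne db c p ρ a b := by
  have h1 : 0 < 1 - ρ := by linarith
  rcases a with _ | x <;> rcases b with _ | y
  · exact le_rfl
  · show 0 ≤ ρ ^ (1 / p) * c
    positivity
  · show 0 ≤ (1 - ρ) ^ (1 / p) * c
    positivity
  · exact le_min hc.le (hdb.nonneg x y)

lemma gospaOne_eq_zero_iff (hdb : IsQMetric db) (hc : 0 < c) (hρ : 0 < ρ) (hρ' : ρ < 1)
    (a b : Option E) : gospaOne db c p ρ a b = 0 ↔ a = b := by
  have h1 : 0 < 1 - ρ := by linarith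
  rcases a with _ | x <;> rcases b with _ | y
  · simp
  · have : 0 < ρ ^ (1 / p) * c := by positivity
    simpa [gospaOne] using this.ne'
  · have : 0 < (1 - ρ) ^ (1 / p) * c := by positivity
    simpa [gospaOne] using this.ne'
  · rw [Option.some_inj, ← hdb.eq_zero_iff]
    show min c (db x y) = 0 ↔ _
    constructor
    · intro h
      rcases min_choice c (db x y) with h' | h' <;> linarith
    · intro h
      rw [h, min_eq_right hc.le]

/-- On `(0, 1)` one has `t ≤ t ^ (1 / p)`. This is what the triangle inequality needs when two
objects are compared through the empty set. -/
lemma one_le_rpow_add_rpow (hp : 1 ≤ p) (hρ : 0 < ρ) (hρ' : ρ < 1) :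
    1 ≤ (1 - ρ) ^ (1 / p) + ρ ^ (1 / p) := by
  have h1 : 0 < 1 - ρ := by linarith
  have hp' : 1 / p ≤ 1 := by rw [div_le_one (by linarith)]; exact hp
  have h2 := Real.rpow_le_rpow_of_exponent_ge hρ hρ'.le hp'
  have h3 := Real.rpow_le_rpow_of_exponent_ge h1 (by linarith) hp'
  rw [Real.rpow_one] at h2 h3
  linarith

lemma gospaOne_triangle (hdb : IsQMetric db) (hc : 0 < c) (hp : 1 ≤ p) (hρ : 0 < ρ)
    (hρ' : ρ < 1) (a b e : Option E) :
    gospaOne db c p ρ a b ≤ gospaOne db c p ρ a e + gospaOne db c p ρ e b := by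
  rcases a with _ | x <;> rcases b with _ | y
  · exact add_nonneg (gospaOne_nonneg hdb hc hρ hρ' _ _) (gospaOne_nonneg hdb hc hρ hρ' _ _)
  · rcases e with _ | z
    · simp
    · exact le_add_of_nonneg_right (gospaOne_nonneg hdb hc hρ hρ' _ _)
  · rcases e with _ | z
    · simp
    · exact le_add_of_nonneg_left (gospaOne_nonneg hdb hc hρ hρ' _ _)
  · rcases e with _ | z
    · calc min c (db x y) ≤ 1 * c := by rw [one_mul]; exact min_le_left _ _
        _ ≤ ((1 - ρ) ^ (1 / p) + ρ ^ (1 / p)) * c :=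
          mul_le_mul_of_nonneg_right (one_le_rpow_add_rpow hp hρ hρ') hc.le
        _ = _ := by rw [add_mul]; rfl
    · show min c (db x y) ≤ min c (db x z) + min c (db z y)
      have h1 := hdb.nonneg x z
      have h2 := hdb.nonneg z y
      have h3 := hdb.triangle x y z
      have h4 := min_le_left c (db x y)
      have h5 := min_le_right c (db x y)
      rcases min_choice c (db x z) with h | h <;> rcases min_choice c (db z y) with h' | h' <;>
        rw [h, h'] <;> linarith

lemma gospaOne_none_some_rpow (hc : 0 < c) (hp : 1 ≤ p) (hρ : 0 < ρ) (y : E) :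
    gospaOne db c p ρ none (some y) ^ p = ρ * c ^ p := by
  show (ρ ^ (1 / p) * c) ^ p = _
  rw [Real.mul_rpow (by positivity) hc.le, ← Real.rpow_mul hρ.le,
    one_div_mul_cancel (by linarith), Real.rpow_one]

lemma gospaOne_some_none_rpow (hc : 0 < c) (hp : 1 ≤ p) (hρ' : ρ < 1) (x : E) :
    gospaOne db c p ρ (some x) none ^ p = (1 - ρ) * c ^ p := by
  have h1 : 0 < 1 - ρ := by linarith
  show ((1 - ρ) ^ (1 / p) * c) ^ p = _
  rw [Real.mul_rpow (by positivity) hc.le, ← Real.rpow_mul h1.le,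
    one_div_mul_cancel (by linarith), Real.rpow_one]

end Gospa

/-! ### Minkowski's inequality for sequences of matchings -/

section FamilyCost

variable {T : ℕ} {E ι ζ κ : Type*} [Fintype ι] [Fintype ζ] [Fintype κ]

/-- The localisation, missed- and false-object cost of a partial matching between two finite
families of sets with at most one element. -/
def familyStepCost (d : Option E → Option E → ℝ) (p : ℝ) (a : ι → Option E) (b : κ → Option E)
    (f : ι ≃. κ) : ℝ :=
  pairingCost (fun x y => d (x.bind a) (y.bind b) ^ p) f

/-- The number of track switches of a sequence of partial matchings. -/
def totalSwitches {ι κ : Type*} [Fintype ι] (f : Fin T → (ι ≃. κ)) : ℝ :=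
  ∑ k : Fin (T - 1), ∑ i, switchCount (f ⟨(k : ℕ), by omega⟩ i) (f ⟨(k : ℕ) + 1, by omega⟩ i)

/-- The cost of a sequence of partial matchings between two families of time-dependent sets with
at most one element. -/
def familyCost (d : Option E → Option E → ℝ) (p γ : ℝ) (a : Fin T → ι → Option E)
    (b : Fin T → κ → Option E) (f : Fin T → (ι ≃. κ)) : ℝ :=
  (∑ k, familyStepCost d p (a k) (b k) (f k)) + γ ^ p * totalSwitches f

lemma totalSwitches_nonneg {ι κ : Type*} [Fintype ι] (f : Fin T → (ι ≃. κ)) : 0 ≤ totalSwitches f :=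
  Finset.sum_nonneg fun _ _ => Finset.sum_nonneg fun _ _ => switchCount_nonneg _ _

lemma familyStepCost_nonneg {d : Option E → Option E → ℝ} (hd : ∀ a b, 0 ≤ d a b) (p : ℝ)
    (a : ι → Option E) (b : κ → Option E) (f : ι ≃. κ) : 0 ≤ familyStepCost d p a b f := by
  unfold familyStepCost
  rw [pairingCost_eq_sum_left]
  refine add_nonneg (Finset.sum_nonneg fun i _ => Real.rpow_nonneg (hd _ _) _)
    (Finset.sum_nonneg fun j _ => ?_)
  split_ifs
  · exact Real.rpow_nonneg (hd _ _) _
  · exact le_rfl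

lemma familyCost_nonneg {d : Option E → Option E → ℝ} (hd : ∀ a b, 0 ≤ d a b) (p : ℝ) {γ : ℝ}
    (hγ : 0 < γ) (a : Fin T → ι → Option E) (b : Fin T → κ → Option E) (f : Fin T → (ι ≃. κ)) :
    0 ≤ familyCost d p γ a b f :=
  add_nonneg (Finset.sum_nonneg fun _ _ => familyStepCost_nonneg hd _ _ _ _)
    (mul_nonneg (Real.rpow_nonneg hγ.le _) (totalSwitches_nonneg f))

lemma totalSwitches_trans_le {ι ζ κ : Type*} [Fintype ι] [Fintype ζ] (f : Fin T → (ι ≃. ζ)) (g : Fin T → (ζ ≃. κ)) :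
    totalSwitches (fun k => (f k).trans (g k)) ≤ totalSwitches f + totalSwitches g := by
  unfold totalSwitches
  rw [← Finset.sum_add_distrib]
  exact Finset.sum_le_sum fun k _ => sum_switchCount_trans_le _ _ _ _

/-- Minkowski's inequality with one extra coordinate, `u ^ (1 / p)` and `v ^ (1 / p)`, carrying the
switch penalties; superadditivity of the `p`-th power turns `w ≤ u + v` into the bound needed there.
-/
lemma Real.Lp_add_le_of_le_add {L : Type*} [Fintype L] {p : ℝ} (hp : 1 ≤ p) {A B C : L → ℝ}
    {u v w : ℝ} (hA : ∀ l, 0 ≤ A l) (hB : ∀ l, 0 ≤ B l) (hC : ∀ l, 0 ≤ C l)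
    (hABC : ∀ l, C l ≤ A l + B l) (hu : 0 ≤ u) (hv : 0 ≤ v) (hw : 0 ≤ w) (huvw : w ≤ u + v) :
    (∑ l, C l ^ p + w) ^ (1 / p)
      ≤ (∑ l, A l ^ p + u) ^ (1 / p) + (∑ l, B l ^ p + v) ^ (1 / p) := by
  have hp0 : 0 < p := by linarith
  have hpow : ∀ t : ℝ, 0 ≤ t → (t ^ (1 / p)) ^ p = t := fun t ht => by
    rw [← Real.rpow_mul ht, one_div_mul_cancel hp0.ne', Real.rpow_one]
  let A' : Option L → ℝ := fun l => l.elim (u ^ (1 / p)) A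
  let B' : Option L → ℝ := fun l => l.elim (v ^ (1 / p)) B
  have hA' : ∀ l ∈ Finset.univ, 0 ≤ A' l := fun l _ => by
    rcases l with _ | l
    exacts [Real.rpow_nonneg hu _, hA l]
  have hB' : ∀ l ∈ Finset.univ, 0 ≤ B' l := fun l _ => by
    rcases l with _ | l
    exacts [Real.rpow_nonneg hv _, hB l]
  have key := Real.Lp_add_le_of_nonneg Finset.univ hp hA' hB'
  simp only [Fintype.sum_option, A', B', Option.elim_none, Option.elim_some, hpow u hu,
    hpow v hv] at key
  rw [add_comm (∑ l, C l ^ p), add_comm (∑ l, A l ^ p), add_comm (∑ l, B l ^ p)]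
  refine le_trans (Real.rpow_le_rpow ?_ ?_ (by positivity)) key
  · exact add_nonneg hw (Finset.sum_nonneg fun l _ => Real.rpow_nonneg (hC l) _)
  · refine add_le_add (huvw.trans ?_)
      (Finset.sum_le_sum fun l _ => Real.rpow_le_rpow (hC l) (hABC l) hp0.le)
    have := Real.add_rpow_le_rpow_add (Real.rpow_nonneg hu (1 / p)) (Real.rpow_nonneg hv (1 / p)) hp
    rwa [hpow u hu, hpow v hv] at this

lemma familyCost_trans_le {d : Option E → Option E → ℝ} (hd : ∀ a b, 0 ≤ d a b)
    (hd0 : d none none = 0) (hdt : ∀ a b e, d a b ≤ d a e + d e b) {p γ : ℝ} (hp : 1 ≤ p)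
    (hγ : 0 < γ) (a : Fin T → ι → Option E) (e : Fin T → ζ → Option E) (b : Fin T → κ → Option E)
    (f : Fin T → (ι ≃. ζ)) (g : Fin T → (ζ ≃. κ)) :
    familyCost d p γ a b (fun k => (f k).trans (g k)) ^ (1 / p)
      ≤ familyCost d p γ a e f ^ (1 / p) + familyCost d p γ e b g ^ (1 / p) := by
  classical
  have hp0 : p ≠ 0 := by linarith
  -- At each time the coordinates are those of `pairingCost_trans`: points `i` unmatched by `f`, all
  -- middle points, and points `j` unmatched by `g`. `A` and `B` are padded with zeros where the
  -- respective factor pays nothing.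
  let A : Fin T × (ι ⊕ ζ ⊕ κ) → ℝ := fun l => match l.2 with
    | .inl i => if f l.1 i = none then d (a l.1 i) none else 0
    | .inr (.inl z) => d (((f l.1).symm z).bind (a l.1)) (e l.1 z)
    | .inr (.inr _) => 0
  let B : Fin T × (ι ⊕ ζ ⊕ κ) → ℝ := fun l => match l.2 with
    | .inl _ => 0
    | .inr (.inl z) => d (e l.1 z) ((g l.1 z).bind (b l.1))
    | .inr (.inr j) => if (g l.1).symm j = none then d none (b l.1 j) else 0
  let C : Fin T × (ι ⊕ ζ ⊕ κ) → ℝ := fun l => match l.2 with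
    | .inl i => if f l.1 i = none then d (a l.1 i) none else 0
    | .inr (.inl z) => d (((f l.1).symm z).bind (a l.1)) ((g l.1 z).bind (b l.1))
    | .inr (.inr j) => if (g l.1).symm j = none then d none (b l.1 j) else 0
  have hA : ∑ l, A l ^ p = ∑ k, familyStepCost d p (a k) (e k) (f k) := by
    rw [Fintype.sum_prod_type]
    refine Finset.sum_congr rfl fun k _ => ?_
    rw [familyStepCost, pairingCost_eq_sum_right]
    simp [A, Real.zero_rpow hp0, apply_ite (· ^ p)]
  have hB : ∑ l, B l ^ p = ∑ k, familyStepCost d p (e k) (b k) (g k) := by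
    rw [Fintype.sum_prod_type]
    refine Finset.sum_congr rfl fun k _ => ?_
    rw [familyStepCost, pairingCost_eq_sum_left]
    simp [B, Real.zero_rpow hp0, apply_ite (· ^ p)]
  have hC : ∑ l, C l ^ p = ∑ k, familyStepCost d p (a k) (b k) ((f k).trans (g k)) := by
    rw [Fintype.sum_prod_type]
    refine Finset.sum_congr rfl fun k _ => ?_
    rw [familyStepCost, pairingCost_trans _ (by simp [hd0, Real.zero_rpow hp0])]
    simp [C, Real.zero_rpow hp0, apply_ite (· ^ p), add_assoc]
  have nn : ∀ (q : Prop) [Decidable q] (x y : Option E), 0 ≤ if q then d x y else 0 :=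
    fun q _ x y => by split_ifs; exacts [hd _ _, le_rfl]
  have hγp : 0 ≤ γ ^ p := Real.rpow_nonneg hγ.le _
  unfold familyCost
  rw [← hA, ← hB, ← hC]
  refine Real.Lp_add_le_of_le_add hp ?_ ?_ ?_ ?_ (mul_nonneg hγp (totalSwitches_nonneg _))
    (mul_nonneg hγp (totalSwitches_nonneg _)) (mul_nonneg hγp (totalSwitches_nonneg _)) ?_
  · rintro ⟨k, i | z | j⟩
    exacts [nn _ _ _, hd _ _, le_rfl]
  · rintro ⟨k, i | z | j⟩
    exacts [le_rfl, hd _ _, nn _ _ _]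
  · rintro ⟨k, i | z | j⟩
    exacts [nn _ _ _, hd _ _, nn _ _ _]
  · rintro ⟨k, i | z | j⟩
    exacts [(add_zero _).ge, hdt _ _ _, (zero_add _).ge]
  · rw [← mul_add]
    exact mul_le_mul_of_nonneg_left (totalSwitches_trans_le f g) hγp

end FamilyCost

/-! ### From assignment vectors to partial matchings -/

section Transport

variable {T : ℕ} {E ι κ : Type*} {X Y : Finset (Trajectory T E)}

/-- The assignment vector given by a partial matching of index types of `X` and `Y`. -/
def assignmentOfPEquiv (e : ι ≃ X) (e' : κ ≃ Y) (f : ι ≃. κ) : AssignmentVector X Y :=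
  ⟨fun i => (f (e.symm i)).map e', fun i i' j h h' => by
    obtain ⟨x, hx, rfl⟩ := Option.map_eq_some_iff.1 h
    obtain ⟨x', hx', hxx⟩ := Option.map_eq_some_iff.1 h'
    rw [e'.injective hxx] at hx'
    exact e.symm.injective (f.inj hx hx')⟩

lemma assignmentOfPEquiv_apply (e : ι ≃ X) (e' : κ ≃ Y) (f : ι ≃. κ) (i : ι) :
    (assignmentOfPEquiv e e' f).1 (e i) = (f i).map e' := by
  simp [assignmentOfPEquiv]

lemma assignmentOfPEquiv_eq_some_iff (e : ι ≃ X) (e' : κ ≃ Y) (f : ι ≃. κ) (i : ι) (j : κ) :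
    (assignmentOfPEquiv e e' f).1 (e i) = some (e' j) ↔ f i = some j := by
  rw [assignmentOfPEquiv_apply]
  simp

lemma assignmentOfPEquiv_surjective (e : ι ≃ X) (e' : κ ≃ Y) :
    Function.Surjective (assignmentOfPEquiv e e') := by
  classical
  intro π
  let f : ι ≃. κ :=
    { toFun := fun i => (π.1 (e i)).map e'.symm
      -- The chosen preimage is unique, because an assignment vector uses no `j` twice.
      invFun := fun j => if h : ∃ i, π.1 (e i) = some (e' j) then some h.choose else none
      inv := fun i j => by
        simp only [Option.map_eq_some_iff]
        constructor
        · intro h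
          split_ifs at h with h'
          obtain rfl := Option.some.inj h
          exact ⟨e' j, h'.choose_spec, by simp⟩
        · rintro ⟨y, hy, rfl⟩
          have h' : ∃ i, π.1 (e i) = some (e' (e'.symm y)) := ⟨i, by simpa using hy⟩
          rw [dif_pos h']
          congr 1
          refine e.injective (π.2 _ _ y ?_ hy)
          simpa using h'.choose_spec }
  refine ⟨f, Subtype.ext (funext fun i => ?_)⟩
  show ((π.1 (e (e.symm i))).map e'.symm).map e' = _
  rw [Option.map_map]
  simp

variable [Fintype ι] [Fintype κ]

open Classical in
lemma sum_eq_sum_assigned_add (f : ι ≃. κ) (φ : κ → ℝ) :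
    ∑ j, φ j = (∑ i, ∑ j, if f i = some j then φ j else 0)
      + ∑ j, if f.symm j = none then φ j else 0 := by
  have h := pairingCost_eq_sum_right (fun (_ : Option ι) (y : Option κ) => y.elim 0 φ) f
  unfold pairingCost at h
  simp only [Option.elim_some, Option.elim_none, ite_self, Finset.sum_const_zero, add_zero,
    zero_add] at h
  exact h.symm

lemma numPresent_eq (e : ι ≃ X) (k : ℕ) :
    (numPresent X k : ℝ) = ∑ i, if ((e i).1.stateAt k).isSome then (1 : ℝ) else 0 := by
  unfold numPresent
  push_cast
  rw [← Finset.sum_coe_sort X, ← e.sum_comp]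

open Classical in
lemma sum_objectAssignment (db : E → E → ℝ) (c p ρ : ℝ) (e : ι ≃ X) (e' : κ ≃ Y) (f : ι ≃. κ)
    (k : ℕ) (φ : X × Y → ℝ) :
    ∑ ij ∈ objectAssignment db c p ρ X Y k (assignmentOfPEquiv e e' f), φ ij
      = ∑ i, ∑ j, if f i = some j then
          (if ((e i).1.stateAt k).isSome ∧ ((e' j).1.stateAt k).isSome ∧
            gospaOne db c p ρ ((e i).1.stateAt k) ((e' j).1.stateAt k) < c
          then φ (e i, e' j) else 0) else 0 := by
  unfold objectAssignment
  rw [Finset.sum_filter, ← (e.prodCongr e').sum_comp, Fintype.sum_prod_type]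
  simp only [Equiv.prodCongr_apply, Prod.map_apply, assignmentOfPEquiv_eq_some_iff, ite_and]

/-- This removes the cut-off: a pair outside the assignment set costs the sum of its false- and
missed-object penalties, and a pair inside it replaces their total `c ^ p` by its own distance. -/
lemma gospaOne_rpow_eq {db : E → E → ℝ} {c p ρ : ℝ} (hc : 0 < c) (hp : 1 ≤ p) (hρ : 0 < ρ)
    (hρ' : ρ < 1) (a b : Option E) [Decidable (gospaOne db c p ρ a b < c)] :
    gospaOne db c p ρ a b ^ p
      = (if a.isSome ∧ b.isSome ∧ gospaOne db c p ρ a b < c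
          then gospaOne db c p ρ a b ^ p - c ^ p else 0)
        + ρ * c ^ p * (if b.isSome then 1 else 0)
        + (1 - ρ) * c ^ p * (if a.isSome then 1 else 0) := by
  rcases a with _ | x <;> rcases b with _ | y
  · simp [Real.zero_rpow (show p ≠ 0 by linarith)]
  · simp [gospaOne_none_some_rpow hc hp hρ]
  · simp [gospaOne_some_none_rpow hc hp hρ']
  · by_cases h : gospaOne db c p ρ (some x) (some y) < c
    · simp [h]; ring
    · have h2 : gospaOne db c p ρ (some x) (some y) = c :=
        le_antisymm (min_le_left _ _) (not_lt.1 h)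
      simp [h2]; ring

lemma stepCost_assignmentOfPEquiv {db : E → E → ℝ} {c p ρ : ℝ} (hc : 0 < c) (hp : 1 ≤ p)
    (hρ : 0 < ρ) (hρ' : ρ < 1) (e : ι ≃ X) (e' : κ ≃ Y) (f : ι ≃. κ) (k : ℕ) :
    stepCost db c p ρ X Y k (assignmentOfPEquiv e e' f)
      = familyStepCost (gospaOne db c p ρ) p (fun i => (e i).1.stateAt k)
          (fun j => (e' j).1.stateAt k) f := by
  classical
  have hX : (numPresent X k : ℝ)
      = (∑ i, ∑ j, if f i = some j then (if ((e i).1.stateAt k).isSome then 1 else 0) else 0)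
        + ∑ i, if f i = none then (if ((e i).1.stateAt k).isSome then 1 else 0) else 0 := by
    refine (numPresent_eq e k).trans ((sum_eq_sum_assigned_add f.symm _).trans ?_)
    rw [Finset.sum_comm]
    simp only [PEquiv.symm_symm, f.eq_some_iff]
    congr!
  have hY := (numPresent_eq e' k).trans (sum_eq_sum_assigned_add f _)
  have hcard : ((objectAssignment db c p ρ X Y k (assignmentOfPEquiv e e' f)).card : ℝ)
      = ∑ ij ∈ objectAssignment db c p ρ X Y k (assignmentOfPEquiv e e' f), 1 := by simp
  have h1 : (∑ i, if f i = none then gospaOne db c p ρ ((e i).1.stateAt k) none ^ p else 0)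
      = (1 - ρ) * c ^ p *
        ∑ i, if f i = none then (if ((e i).1.stateAt k).isSome then 1 else 0) else 0 := by
    rw [Finset.mul_sum]
    refine Finset.sum_congr rfl fun i _ => ?_
    rw [gospaOne_rpow_eq hc hp hρ hρ']
    simp
  have h2 : (∑ j, if f.symm j = none then gospaOne db c p ρ none ((e' j).1.stateAt k) ^ p else 0)
      = ρ * c ^ p *
        ∑ j, if f.symm j = none then (if ((e' j).1.stateAt k).isSome then 1 else 0) else 0 := by
    rw [Finset.mul_sum]
    refine Finset.sum_congr rfl fun i _ => ?_
    rw [gospaOne_rpow_eq hc hp hρ hρ']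
    simp
  unfold stepCost familyStepCost pairingCost
  rw [hcard, hX, hY, sum_objectAssignment, sum_objectAssignment]
  simp only [Option.bind_some, Option.bind_none]
  rw [h1, h2]
  have h3 : (∑ i, ∑ j, if f i = some j then
        gospaOne db c p ρ ((e i).1.stateAt k) ((e' j).1.stateAt k) ^ p else 0)
      = (∑ i, ∑ j, if f i = some j then
          (if ((e i).1.stateAt k).isSome ∧ ((e' j).1.stateAt k).isSome ∧
            gospaOne db c p ρ ((e i).1.stateAt k) ((e' j).1.stateAt k) < c
          then gospaOne db c p ρ ((e i).1.stateAt k) ((e' j).1.stateAt k) ^ p else 0) else 0)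
        - c ^ p * (∑ i, ∑ j, if f i = some j then
          (if ((e i).1.stateAt k).isSome ∧ ((e' j).1.stateAt k).isSome ∧
            gospaOne db c p ρ ((e i).1.stateAt k) ((e' j).1.stateAt k) < c
          then 1 else 0) else 0)
        + ρ * c ^ p * (∑ i, ∑ j, if f i = some j then
            (if ((e' j).1.stateAt k).isSome then 1 else 0) else 0)
        + (1 - ρ) * c ^ p * (∑ i, ∑ j, if f i = some j then
            (if ((e i).1.stateAt k).isSome then 1 else 0) else 0) := by
    simp only [Finset.mul_sum, ← Finset.sum_add_distrib, ← Finset.sum_sub_distrib]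
    refine Finset.sum_congr rfl fun i _ => Finset.sum_congr rfl fun j _ => ?_
    by_cases h : f i = some j
    · simp only [if_pos h]
      refine (gospaOne_rpow_eq hc hp hρ hρ' _ _).trans ?_
      by_cases hq : ((e i).1.stateAt k).isSome ∧ ((e' j).1.stateAt k).isSome ∧
          gospaOne db c p ρ ((e i).1.stateAt k) ((e' j).1.stateAt k) < c
      · simp only [if_pos hq, mul_one]
      · simp only [if_neg hq, mul_zero, sub_zero]
    · simp only [if_neg h]
      ring
  rw [h3]
  ring

lemma sequenceCost_assignmentOfPEquiv {db : E → E → ℝ} {c p ρ : ℝ} (hc : 0 < c) (hp : 1 ≤ p)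
    (hρ : 0 < ρ) (hρ' : ρ < 1) (γ : ℝ) (e : ι ≃ X) (e' : κ ≃ Y) (f : Fin T → (ι ≃. κ)) :
    sequenceCost db c p γ ρ X Y (fun k => assignmentOfPEquiv e e' (f k))
      = familyCost (gospaOne db c p ρ) p γ (fun k i => (e i).1.stateAt ((k : ℕ) + 1))
          (fun k j => (e' j).1.stateAt ((k : ℕ) + 1)) f := by
  unfold sequenceCost familyCost totalSwitches
  congr 1
  · exact Finset.sum_congr rfl fun k _ => stepCost_assignmentOfPEquiv hc hp hρ hρ' e e' _ _
  · rw [Finset.mul_sum]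
    refine Finset.sum_congr rfl fun k _ => ?_
    unfold switchCost
    rw [← e.sum_comp]
    simp only [assignmentOfPEquiv_apply, switchCount_map e'.injective]

/-- The index types are arbitrary: the sets themselves serve the q-metric axioms, while `Fin n`
serves measurability, where matchings must not depend on the sets. -/
lemma tgospa_eq_iInf_familyCost {db : E → E → ℝ} {c p ρ : ℝ} (hc : 0 < c) (hp : 1 ≤ p)
    (hρ : 0 < ρ) (hρ' : ρ < 1) (γ : ℝ) (e : ι ≃ X) (e' : κ ≃ Y) :
    tgospa db c p γ ρ X Y = ⨅ f : Fin T → (ι ≃. κ),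
      familyCost (gospaOne db c p ρ) p γ (fun k i => (e i).1.stateAt ((k : ℕ) + 1))
          (fun k j => (e' j).1.stateAt ((k : ℕ) + 1)) f ^ (1 / p) := by
  unfold tgospa
  refine (Function.Surjective.iInf_congr
    (fun (f : Fin T → (ι ≃. κ)) k => assignmentOfPEquiv e e' (f k)) ?_ fun f => ?_).symm
  · exact Function.Surjective.comp_left (assignmentOfPEquiv_surjective e e')
  · rw [sequenceCost_assignmentOfPEquiv hc hp hρ hρ']

end Transport

/-! ### T-GOSPA is a q-metric on finite sets of trajectories -/

section Deterministic

instance PEquiv.instFinite {α β : Type*} [Finite α] [Finite β] : Finite (α ≃. β) :=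
  Finite.of_injective (fun f : α ≃. β => (f : α → Option β)) DFunLike.coe_injective

lemma Trajectory.stateAt_isSome_iff {T : ℕ} {E : Type*} (X : Trajectory T E) (k : ℕ) :
    (X.stateAt k).isSome ↔ X.start ≤ k ∧ k < X.start + X.duration := by
  unfold Trajectory.stateAt
  split_ifs with h <;> simp [h]

lemma Trajectory.start_mem {T : ℕ} {E : Type*} (X : Trajectory T E) :
    1 ≤ X.start ∧ X.start ≤ T ∧ 1 ≤ X.duration ∧ X.start + X.duration ≤ T + 1 :=
  X.1.2

/-- The times at which a trajectory is present form a nonempty interval inside `1, …, T`, which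
determines start and duration; the states are then read off. -/
lemma Trajectory.ext_stateAt {T : ℕ} {E : Type*} {X Y : Trajectory T E}
    (h : ∀ k, 1 ≤ k → k ≤ T → X.stateAt k = Y.stateAt k) : X = Y := by
  have h' : ∀ k, 1 ≤ k → k ≤ T → ((X.start ≤ k ∧ k < X.start + X.duration) ↔
      (Y.start ≤ k ∧ k < Y.start + Y.duration)) := fun k h1 h2 => by
    rw [← X.stateAt_isSome_iff, ← Y.stateAt_isSome_iff, h k h1 h2]
  obtain ⟨hX1, hX2, hX3, hX4⟩ := X.start_mem
  obtain ⟨hY1, hY2, hY3, hY4⟩ := Y.start_mem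
  have hs : X.start = Y.start := by
    have h1 := (h' X.start hX1 hX2).1 (by omega)
    have h2 := (h' Y.start hY1 hY2).2 (by omega)
    omega
  have hd : X.duration = Y.duration := by
    have h1 := (h' (X.start + X.duration - 1) (by omega) (by omega)).1 (by omega)
    have h2 := (h' (Y.start + Y.duration - 1) (by omega) (by omega)).2 (by omega)
    omega
  obtain ⟨⟨⟨w, v⟩, hX⟩, x⟩ := X
  obtain ⟨⟨⟨w', v'⟩, hY⟩, y⟩ := Y
  obtain rfl : w = w' := hs
  obtain rfl : v = v' := hd
  congr 1
  funext i
  have hi : (i : ℕ) < v := i.2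
  have h1 := h (w + i) (by simp only at hX; omega) (by simp only at hX; omega)
  simpa [Trajectory.stateAt, Trajectory.start, Trajectory.duration, hi] using h1

variable {T : ℕ} {E : Type*} {db : E → E → ℝ} {c p γ ρ : ℝ}

lemma tgospa_nonneg (hdb : IsQMetric db) (hc : 0 < c) (hp : 1 ≤ p) (hγ : 0 < γ) (hρ : 0 < ρ)
    (hρ' : ρ < 1) (X Y : Finset (Trajectory T E)) : 0 ≤ tgospa db c p γ ρ X Y := by
  rw [tgospa_eq_iInf_familyCost hc hp hρ hρ' γ (Equiv.refl X) (Equiv.refl Y)]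
  exact Real.iInf_nonneg fun f => Real.rpow_nonneg
    (familyCost_nonneg (gospaOne_nonneg hdb hc hρ hρ') _ hγ _ _ _) _

lemma tgospa_le (hc : 0 < c) (hp : 1 ≤ p) (hρ : 0 < ρ)
    (hρ' : ρ < 1) (X Y : Finset (Trajectory T E)) (f : Fin T → (X ≃. Y)) :
    tgospa db c p γ ρ X Y ≤ familyCost (gospaOne db c p ρ) p γ
      (fun k i => i.1.stateAt ((k : ℕ) + 1)) (fun k j => j.1.stateAt ((k : ℕ) + 1)) f
        ^ (1 / p) := by
  rw [tgospa_eq_iInf_familyCost hc hp hρ hρ' γ (Equiv.refl X) (Equiv.refl Y)]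
  exact ciInf_le (Set.finite_range _).bddBelow f

lemma exists_tgospa_eq (hc : 0 < c) (hp : 1 ≤ p) (hρ : 0 < ρ)
    (hρ' : ρ < 1) (X Y : Finset (Trajectory T E)) :
    ∃ f : Fin T → (X ≃. Y), tgospa db c p γ ρ X Y = familyCost (gospaOne db c p ρ) p γ
      (fun k i => i.1.stateAt ((k : ℕ) + 1)) (fun k j => j.1.stateAt ((k : ℕ) + 1)) f
        ^ (1 / p) := by
  rw [tgospa_eq_iInf_familyCost hc hp hρ hρ' γ (Equiv.refl X) (Equiv.refl Y)]
  obtain ⟨f, hf⟩ := exists_eq_ciInf_of_finite (f := fun f : Fin T → (X ≃. Y) =>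
    familyCost (gospaOne db c p ρ) p γ (fun k i => i.1.stateAt ((k : ℕ) + 1))
      (fun k j => j.1.stateAt ((k : ℕ) + 1)) f ^ (1 / p))
  exact ⟨f, hf.symm⟩

lemma tgospa_triangle (hdb : IsQMetric db) (hc : 0 < c) (hp : 1 ≤ p) (hγ : 0 < γ) (hρ : 0 < ρ)
    (hρ' : ρ < 1) (X Y Z : Finset (Trajectory T E)) :
    tgospa db c p γ ρ X Y ≤ tgospa db c p γ ρ X Z + tgospa db c p γ ρ Z Y := by
  obtain ⟨f, hf⟩ := exists_tgospa_eq (db := db) (γ := γ) hc hp hρ hρ' X Z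
  obtain ⟨g, hg⟩ := exists_tgospa_eq (db := db) (γ := γ) hc hp hρ hρ' Z Y
  rw [hf, hg]
  exact (tgospa_le hc hp hρ hρ' X Y fun k => (f k).trans (g k)).trans
    (familyCost_trans_le (gospaOne_nonneg hdb hc hρ hρ') rfl (gospaOne_triangle hdb hc hp hρ hρ')
      hp hγ _ _ _ _ _)

lemma totalSwitches_eq_zero {ι κ : Type*} [Fintype ι] {f : Fin T → (ι ≃. κ)}
    (h : totalSwitches f = 0) (k l : Fin T) : f k = f l := by
  have step : ∀ (n : ℕ) (hn : n + 1 < T), f ⟨n, by omega⟩ = f ⟨n + 1, hn⟩ := fun n hn => by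
    have h1 := (Finset.sum_eq_zero_iff_of_nonneg fun _ _ =>
      Finset.sum_nonneg fun _ _ => switchCount_nonneg _ _).1 h ⟨n, by omega⟩ (Finset.mem_univ _)
    refine PEquiv.ext fun i => switchCount_eq_zero ?_
    exact (Finset.sum_eq_zero_iff_of_nonneg fun _ _ => switchCount_nonneg _ _).1 h1 i
      (Finset.mem_univ _)
  have zero : ∀ (n : ℕ) (hn : n < T), f ⟨n, hn⟩ = f ⟨0, by omega⟩ := by
    intro n
    induction n with
    | zero => exact fun _ => rfl
    | succ n ih => exact fun hn => (step n hn).symm.trans (ih (by omega))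
  exact (zero k k.2).trans (zero l l.2).symm

lemma familyStepCost_eq_zero_left {ι κ : Type*} [Fintype ι] [Fintype κ]
    (hdb : IsQMetric db) (hc : 0 < c) (hp : 1 ≤ p) (hρ : 0 < ρ)
    (hρ' : ρ < 1) {a : ι → Option E} {b : κ → Option E} {f : ι ≃. κ}
    (h : familyStepCost (gospaOne db c p ρ) p a b f = 0) (i : ι) : a i = (f i).bind b := by
  have hnn := gospaOne_nonneg (p := p) hdb hc hρ hρ'
  have nn : ∀ x y, 0 ≤ gospaOne db c p ρ x y ^ p := fun x y => Real.rpow_nonneg (hnn x y) _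
  rw [familyStepCost, pairingCost_eq_sum_left, add_eq_zero_iff_of_nonneg
    (Finset.sum_nonneg fun _ _ => nn _ _)
    (Finset.sum_nonneg fun _ _ => by split_ifs; exacts [nn _ _, le_rfl])] at h
  have h1 := (Finset.sum_eq_zero_iff_of_nonneg fun _ _ => nn _ _).1 h.1 i (Finset.mem_univ _)
  rw [Real.rpow_eq_zero (hnn _ _) (by linarith), gospaOne_eq_zero_iff hdb hc hρ hρ'] at h1
  exact h1

lemma familyStepCost_eq_zero_right {ι κ : Type*} [Fintype ι] [Fintype κ]
    (hdb : IsQMetric db) (hc : 0 < c) (hp : 1 ≤ p) (hρ : 0 < ρ)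
    (hρ' : ρ < 1) {a : ι → Option E} {b : κ → Option E} {f : ι ≃. κ}
    (h : familyStepCost (gospaOne db c p ρ) p a b f = 0) (j : κ) :
    b j = (f.symm j).bind a := by
  have hnn := gospaOne_nonneg (p := p) hdb hc hρ hρ'
  have nn : ∀ x y, 0 ≤ gospaOne db c p ρ x y ^ p := fun x y => Real.rpow_nonneg (hnn x y) _
  rw [familyStepCost, pairingCost_eq_sum_right, add_eq_zero_iff_of_nonneg
    (Finset.sum_nonneg fun _ _ => by split_ifs; exacts [nn _ _, le_rfl])
    (Finset.sum_nonneg fun _ _ => nn _ _)] at h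
  have h1 := (Finset.sum_eq_zero_iff_of_nonneg fun _ _ => nn _ _).1 h.2 j (Finset.mem_univ _)
  rw [Real.rpow_eq_zero (hnn _ _) (by linarith), gospaOne_eq_zero_iff hdb hc hρ hρ'] at h1
  exact h1.symm

/-- A trajectory whose states agree at all times with those of an optional member of `Y`
belongs to `Y`. -/
lemma mem_of_stateAt_eq_bind {Y : Finset (Trajectory T E)} {x : Trajectory T E} {o : Option Y}
    (h : ∀ k : Fin T, x.stateAt ((k : ℕ) + 1) = o.bind fun y => y.1.stateAt ((k : ℕ) + 1)) :
    x ∈ Y := by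
  have h' : ∀ k, 1 ≤ k → k ≤ T → x.stateAt k = o.bind fun y => y.1.stateAt k := fun k h1 h2 => by
    have := h ⟨k - 1, by omega⟩
    simpa only [Nat.sub_add_cancel h1] using this
  rcases o with _ | y
  -- An absent partner is impossible, since every trajectory is present at its start time.
  · obtain ⟨h1, h2, h3, h4⟩ := x.start_mem
    have h5 : (x.stateAt x.start).isSome := (x.stateAt_isSome_iff _).2 ⟨le_rfl, by omega⟩
    rw [h' _ h1 h2] at h5
    simp at h5
  · rw [Trajectory.ext_stateAt (Y := y.1) h']
    exact y.2

lemma tgospa_eq_zero_iff (hdb : IsQMetric db) (hc : 0 < c) (hp : 1 ≤ p) (hγ : 0 < γ) (hρ : 0 < ρ)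
    (hρ' : ρ < 1) (X Y : Finset (Trajectory T E)) : tgospa db c p γ ρ X Y = 0 ↔ X = Y := by
  have hnn := gospaOne_nonneg (p := p) hdb hc hρ hρ'
  have hp0 : p ≠ 0 := by linarith
  constructor
  · intro h
    obtain ⟨f, hf⟩ := exists_tgospa_eq (db := db) (γ := γ) hc hp hρ hρ' X Y
    rw [h, eq_comm, Real.rpow_eq_zero (familyCost_nonneg hnn _ hγ _ _ _) (by positivity),
      familyCost, add_eq_zero_iff_of_nonneg
        (Finset.sum_nonneg fun _ _ => familyStepCost_nonneg hnn _ _ _ _)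
        (mul_nonneg (Real.rpow_nonneg hγ.le _) (totalSwitches_nonneg f)),
      mul_eq_zero, or_iff_right (Real.rpow_pos_of_pos hγ p).ne'] at hf
    have hconst := totalSwitches_eq_zero hf.2
    have hstep := fun k => (Finset.sum_eq_zero_iff_of_nonneg fun _ _ =>
      familyStepCost_nonneg hnn _ _ _ _).1 hf.1 k (Finset.mem_univ _)
    -- A time step at which to read the constant matching exists only if `T` is positive, which any
    -- trajectory guarantees.
    have hT : ∀ x : Trajectory T E, 0 < T := fun x => by
      have := x.start_mem
      omega
    refine Finset.Subset.antisymm (fun x hx => ?_) fun y hy => ?_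
    · refine mem_of_stateAt_eq_bind (o := f ⟨0, hT x⟩ ⟨x, hx⟩) fun k => ?_
      rw [hconst _ k]
      exact familyStepCost_eq_zero_left hdb hc hp hρ hρ' (hstep k) ⟨x, hx⟩
    · refine mem_of_stateAt_eq_bind (o := (f ⟨0, hT y⟩).symm ⟨y, hy⟩) fun k => ?_
      rw [hconst _ k]
      exact familyStepCost_eq_zero_right hdb hc hp hρ hρ' (hstep k) ⟨y, hy⟩
  · rintro rfl
    refine le_antisymm ?_ (tgospa_nonneg hdb hc hp hγ hρ hρ' X X)
    refine (tgospa_le hc hp hρ hρ' X X fun _ => PEquiv.refl X).trans_eq ?_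
    have hself : ∀ o, gospaOne db c p ρ o o = 0 := fun o =>
      (gospaOne_eq_zero_iff hdb hc hρ hρ' o o).2 rfl
    have : familyCost (gospaOne db c p ρ) p γ (fun (k : Fin T) (i : X) =>
        i.1.stateAt ((k : ℕ) + 1)) (fun k j => j.1.stateAt ((k : ℕ) + 1))
        (fun _ => PEquiv.refl X) = 0 := by
      simp [familyCost, totalSwitches, switchCount_self, familyStepCost, pairingCost_eq_sum_left,
        hself, Real.zero_rpow hp0]
    rw [this, Real.zero_rpow (by positivity)]

/-- The empty matching never switches, and each object costs at most `c ^ p` at each of the `T`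
times. -/
lemma tgospa_le_card (hc : 0 < c) (hp : 1 ≤ p) (hρ : 0 < ρ)
    (hρ' : ρ < 1) (X Y : Finset (Trajectory T E)) :
    tgospa db c p γ ρ X Y ≤ (T * c ^ p * ((X.card : ℝ) + Y.card)) ^ (1 / p) := by
  have hcp : 0 < c ^ p := Real.rpow_pos_of_pos hc p
  have h1 : ∀ o, 0 ≤ gospaOne db c p ρ o none ^ p ∧ gospaOne db c p ρ o none ^ p ≤ c ^ p := by
    rintro (_ | x)
    · simp [Real.zero_rpow (show p ≠ 0 by linarith), hcp.le]
    · rw [gospaOne_some_none_rpow hc hp hρ']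
      constructor <;> nlinarith
  have h2 : ∀ o, 0 ≤ gospaOne db c p ρ none o ^ p ∧ gospaOne db c p ρ none o ^ p ≤ c ^ p := by
    rintro (_ | x)
    · simp [Real.zero_rpow (show p ≠ 0 by linarith), hcp.le]
    · rw [gospaOne_none_some_rpow hc hp hρ]
      constructor <;> nlinarith
  have key : familyCost (gospaOne db c p ρ) p γ (fun (k : Fin T) (i : X) =>
        i.1.stateAt ((k : ℕ) + 1)) (fun k (j : Y) => j.1.stateAt ((k : ℕ) + 1)) (fun _ => ⊥)
      = ∑ k : Fin T, ((∑ i : X, gospaOne db c p ρ (i.1.stateAt ((k : ℕ) + 1)) none ^ p)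
        + ∑ j : Y, gospaOne db c p ρ none (j.1.stateAt ((k : ℕ) + 1)) ^ p) := by
    simp [familyCost, totalSwitches, switchCount_self, familyStepCost, pairingCost_eq_sum_left]
  refine (tgospa_le hc hp hρ hρ' X Y fun _ => ⊥).trans
    (Real.rpow_le_rpow ?_ ?_ (by positivity))
  · rw [key]
    exact Finset.sum_nonneg fun k _ => add_nonneg (Finset.sum_nonneg fun _ _ => (h1 _).1)
      (Finset.sum_nonneg fun _ _ => (h2 _).1)
  · rw [key]
    calc _ ≤ ∑ k : Fin T, ((∑ i : X, c ^ p) + ∑ j : Y, c ^ p) :=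
          Finset.sum_le_sum fun k _ => add_le_add (Finset.sum_le_sum fun _ _ => (h1 _).2)
            (Finset.sum_le_sum fun _ _ => (h2 _).2)
      _ = _ := by
        simp
        ring

end Deterministic

/-! ### Joint measurability for functions of two random finite sets -/

section FiniteSetMeasurability

open ProbabilityTheory

variable {F : Type*} [MeasurableSpace F]

/-- The enumeration of a finite set given by a bijection with `Fin n`. -/
def tupleOfEquiv {F : Type*} {n : ℕ} {s : Finset F} (e : Fin n ≃ s) :
    {x : Fin n → F // Function.Injective x} :=
  ⟨fun i => (e i).1, Subtype.val_injective.comp e.injective⟩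

/-- The finite set of the entries of an injective tuple. -/
def finsetOfTuple {F : Type*} {n : ℕ} (x : {x : Fin n → F // Function.Injective x}) : Finset F :=
  Finset.univ.map ⟨x.1, x.2⟩

lemma finsetOfTuple_tupleOfEquiv {F : Type*} {n : ℕ} {s : Finset F} (e : Fin n ≃ s) :
    finsetOfTuple (tupleOfEquiv e) = s := by
  ext y
  simp only [finsetOfTuple, tupleOfEquiv, Finset.mem_map, Finset.mem_univ, true_and,
    Function.Embedding.coeFn_mk]
  constructor
  · rintro ⟨i, rfl⟩
    exact (e i).2
  · intro hy
    exact ⟨e.symm ⟨y, hy⟩, by simp⟩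

/-- An injective tuple enumerates the set of its entries. -/
def equivFinsetOfTuple {F : Type*} {n : ℕ} (x : {x : Fin n → F // Function.Injective x}) :
    Fin n ≃ finsetOfTuple x :=
  Equiv.ofBijective (fun i => ⟨x.1 i, Finset.mem_map.2 ⟨i, Finset.mem_univ _, rfl⟩⟩)
    ⟨fun i j h => x.2 (congrArg Subtype.val h), fun y => by
      obtain ⟨i, -, hi⟩ := Finset.mem_map.1 y.2
      exact ⟨i, Subtype.ext hi⟩⟩

@[simp] lemma equivFinsetOfTuple_apply {F : Type*} {n : ℕ}
    (x : {x : Fin n → F // Function.Injective x}) (i : Fin n) :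
    (equivFinsetOfTuple x i).1 = x.1 i := rfl

lemma measurable_finiteSetSigma_iff {β : Type*} [MeasurableSpace β] {g : Finset F → β} :
    Measurable[finiteSetSigma F] g ↔
      ∀ n, Measurable fun x : {x : Fin n → F // Function.Injective x} => g (finsetOfTuple x) := by
  constructor
  · intro h n t ht
    exact MeasurableSpace.measurableSet_iInf.1 (h ht) n
  · intro h t ht
    exact MeasurableSpace.measurableSet_iInf.2 fun n => h n ht

open Classical in
/-- The counting measure on the enumerations by `Fin n` of a finite set. -/
def enumMeasure (n : ℕ) (s : Finset F) : Measure {x : Fin n → F // Function.Injective x} :=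
  ∑ e : Fin n ≃ s, Measure.dirac (tupleOfEquiv e)

open Classical in
lemma enumMeasure_apply (n : ℕ) (s : Finset F) {B : Set {x : Fin n → F // Function.Injective x}}
    (hB : MeasurableSet B) :
    enumMeasure n s B = ∑ e : Fin n ≃ s, B.indicator 1 (tupleOfEquiv e) := by
  simp only [enumMeasure, Measure.finsetSum_apply, Measure.dirac_apply' _ hB]

lemma enumMeasure_univ_le (n : ℕ) (s : Finset F) :
    enumMeasure n s Set.univ ≤ (n.factorial : ENNReal) := by
  classical
  rw [enumMeasure_apply n s MeasurableSet.univ]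
  simp only [Set.indicator_univ, Pi.one_apply, Finset.sum_const, Finset.card_univ, nsmul_eq_mul,
    mul_one]
  rcases isEmpty_or_nonempty (Fin n ≃ s) with h | ⟨⟨e⟩⟩
  · simp
  · rw [Fintype.card_equiv e, Fintype.card_fin]

lemma measurable_enumMeasure (n : ℕ) : Measurable[finiteSetSigma F] (enumMeasure (F := F) n) := by
  classical
  refine measurable_finiteSetSigma_iff.2 fun m => Measure.measurable_of_measurable_coe _
    fun B hB => ?_
  simp only [enumMeasure_apply n _ hB]
  by_cases hmn : m = n
  · subst hmn
    -- The enumerations of the set of entries of `x` are the permutations of `x`, so the sum runs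
    -- over an index set independent of `x`.
    have : ∀ x : {x : Fin m → F // Function.Injective x},
        ∑ e : Fin m ≃ finsetOfTuple x, (B.indicator 1 (tupleOfEquiv e) : ENNReal)
          = ∑ σ : Equiv.Perm (Fin m), (B.indicator 1
            ⟨x.1 ∘ σ, x.2.comp σ.injective⟩ : ENNReal) := fun x => by
      rw [← ((Equiv.refl (Fin m)).equivCongr (equivFinsetOfTuple x)).sum_comp]
      rfl
    simp only [this]
    refine Finset.measurable_fun_sum _ fun σ _ => (measurable_one.indicator hB).comp ?_
    refine Measurable.subtype_mk (measurable_pi_lambda _ fun i => ?_)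
    exact (measurable_pi_apply (σ i)).comp measurable_subtype_coe
  · have : ∀ x : {x : Fin m → F // Function.Injective x},
        IsEmpty (Fin n ≃ finsetOfTuple x) := fun x => ⟨fun e => hmn (by
          simpa using Fintype.card_congr ((equivFinsetOfTuple x).trans e.symm))⟩
    have h0 : ∀ x : {x : Fin m → F // Function.Injective x},
        ∑ e : Fin n ≃ finsetOfTuple x, (B.indicator 1 (tupleOfEquiv e) : ENNReal) = 0 :=
      fun x => by
        have := this x
        exact Fintype.sum_empty _
    simp only [h0]
    exact measurable_const

open Classical in
lemma enumMeasure_prod_apply (n m : ℕ) (s t : Finset F)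
    {A : Set ({x : Fin n → F // Function.Injective x} × {x : Fin m → F // Function.Injective x})}
    (hA : MeasurableSet A) [SFinite (enumMeasure m t)] :
    (enumMeasure n s).prod (enumMeasure m t) A
      = ∑ e : Fin n ≃ s, ∑ e' : Fin m ≃ t, A.indicator 1 (tupleOfEquiv e, tupleOfEquiv e') := by
  rw [Measure.prod_apply hA]
  have h1 := measurable_measure_prodMk_left (ν := enumMeasure m t) hA
  conv_lhs => rw [enumMeasure]
  rw [lintegral_finsetSum_measure]
  refine Finset.sum_congr rfl fun e _ => ?_
  rw [lintegral_dirac' _ h1, enumMeasure_apply _ _ (measurable_prodMk_left hA)]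
  rfl

/-- A function of two finite sets that is measurable on pairs of injective tuples is measurable
along measurable maps. -/
lemma measurable_comp_finiteSetSigma {Ω β : Type*} [MeasurableSpace Ω] [MeasurableSpace β]
    {g : Finset F → Finset F → β}
    (hg : ∀ n m, Measurable fun z : {x : Fin n → F // Function.Injective x} ×
      {x : Fin m → F // Function.Injective x} => g (finsetOfTuple z.1) (finsetOfTuple z.2))
    {X Y : Ω → Finset F} (hX : Measurable[_, finiteSetSigma F] X)
    (hY : Measurable[_, finiteSetSigma F] Y) : Measurable fun ω => g (X ω) (Y ω) := by
  classical
  intro S hS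
  -- The σ-algebra describes functions of a single set, so pairs need an argument. The kernels of
  -- all enumerations stand in for a measurable choice of one, and finite kernels have measurable
  -- products.
  let κ (Z : Ω → Finset F) (hZ : Measurable[_, finiteSetSigma F] Z) (n : ℕ) :
      Kernel Ω {x : Fin n → F // Function.Injective x} :=
    ⟨fun ω => enumMeasure n (Z ω), (measurable_enumMeasure n).comp hZ⟩
  have hfin : ∀ Z hZ n, IsFiniteKernel (κ Z hZ n) := fun Z hZ n =>
    ⟨⟨n.factorial, ENNReal.natCast_lt_top _, fun ω => enumMeasure_univ_le n (Z ω)⟩⟩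
  let A (n m : ℕ) : Set ({x : Fin n → F // Function.Injective x} ×
      {x : Fin m → F // Function.Injective x}) :=
    (fun z => g (finsetOfTuple z.1) (finsetOfTuple z.2)) ⁻¹' S
  have hA : ∀ n m, MeasurableSet (A n m) := fun n m => hg n m hS
  have hmass : ∀ n m ω, (κ X hX n ×ₖ κ Y hY m) ω (A n m)
      = ∑ e : Fin n ≃ X ω, ∑ e' : Fin m ≃ Y ω,
        (A n m).indicator 1 (tupleOfEquiv e, tupleOfEquiv e') := fun n m ω => by
    have : IsFiniteMeasure (enumMeasure m (Y ω)) :=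
      ⟨(enumMeasure_univ_le m (Y ω)).trans_lt (ENNReal.natCast_lt_top _)⟩
    have := hfin X hX n
    have := hfin Y hY m
    rw [Kernel.prod_apply]
    exact enumMeasure_prod_apply n m (X ω) (Y ω) (hA n m)
  -- Whether a pair of enumerations lies in `A n m` depends only on the two sets. Enumerations exist
  -- when `n` and `m` are the cardinalities, so the event says that some `A n m` is charged.
  have hset : (fun ω => g (X ω) (Y ω)) ⁻¹' S
      = ⋃ (n : ℕ) (m : ℕ), {ω | (κ X hX n ×ₖ κ Y hY m) ω (A n m) ≠ 0} := by
    ext ω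
    have hmem : ∀ n m (e : Fin n ≃ X ω) (e' : Fin m ≃ Y ω),
        (tupleOfEquiv e, tupleOfEquiv e') ∈ A n m ↔ g (X ω) (Y ω) ∈ S := fun n m e e' => by
      simp only [A, Set.mem_preimage, finsetOfTuple_tupleOfEquiv]
    simp only [Set.mem_preimage, Set.mem_iUnion, Set.mem_ofPred_eq, hmass]
    constructor
    · intro h
      refine ⟨(X ω).card, (Y ω).card, fun h0 => ?_⟩
      have h1 := Finset.sum_eq_zero_iff.1 h0 (X ω).equivFin.symm (Finset.mem_univ _)
      have h2 := Finset.sum_eq_zero_iff.1 h1 (Y ω).equivFin.symm (Finset.mem_univ _)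
      rw [Set.indicator_of_mem ((hmem _ _ _ _).2 h)] at h2
      simp at h2
    · rintro ⟨n, m, h0⟩
      by_contra h
      refine h0 (Finset.sum_eq_zero fun e _ => Finset.sum_eq_zero fun e' _ => ?_)
      exact Set.indicator_of_notMem (fun hm => h ((hmem _ _ _ _).1 hm)) _
  rw [hset]
  refine MeasurableSet.iUnion fun n => MeasurableSet.iUnion fun m => ?_
  exact (Kernel.measurable_coe _ (hA n m)) (measurableSet_singleton 0).compl

end FiniteSetMeasurability

/-! ### Measurability of T-GOSPA along random finite sets -/

section TGOSPAMeasurability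

variable {T : ℕ} {E : Type*} [MeasurableSpace E]

lemma measurable_sigma_iff {α β : Type*} {γ : α → Type*} [∀ a, MeasurableSpace (γ a)]
    [MeasurableSpace β] {g : (Σ a, γ a) → β} :
    Measurable g ↔ ∀ a, Measurable fun x : γ a => g ⟨a, x⟩ := by
  constructor
  · intro h a t ht
    exact MeasurableSpace.measurableSet_iInf.1 (h ht) a
  · intro h t ht
    exact MeasurableSpace.measurableSet_iInf.2 fun a => h a ht

lemma measurableSet_stateAt_isSome (k : ℕ) :
    MeasurableSet {X : Trajectory T E | (X.stateAt k).isSome} := by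
  refine MeasurableSpace.measurableSet_iInf.2 fun s => ?_
  show MeasurableSet {x : Fin s.1.2 → E | (Trajectory.stateAt (T := T) ⟨s, x⟩ k).isSome}
  simp only [Trajectory.stateAt_isSome_iff]
  exact MeasurableSet.const (s.1.1 ≤ k ∧ k < s.1.1 + s.1.2)

lemma measurable_stateAt_getD (k : ℕ) (x₀ : E) :
    Measurable fun X : Trajectory T E => (X.stateAt k).getD x₀ := by
  refine measurable_sigma_iff.2 fun s => ?_
  by_cases h : s.1.1 ≤ k ∧ k < s.1.1 + s.1.2
  · have : ∀ x : Fin s.1.2 → E, (Trajectory.stateAt (T := T) ⟨s, x⟩ k).getD x₀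
        = x ⟨k - s.1.1, by omega⟩ := fun x => by
      have h' : Trajectory.start (T := T) ⟨s, x⟩ ≤ k ∧
        k < Trajectory.start (T := T) ⟨s, x⟩ + Trajectory.duration (T := T) ⟨s, x⟩ := h
      rw [Trajectory.stateAt, dif_pos h']
      rfl
    simp only [this]
    exact measurable_pi_apply _
  · have : ∀ x : Fin s.1.2 → E, (Trajectory.stateAt (T := T) ⟨s, x⟩ k).getD x₀ = x₀ := fun x => by
      have h' : ¬ (Trajectory.start (T := T) ⟨s, x⟩ ≤ k ∧
        k < Trajectory.start (T := T) ⟨s, x⟩ + Trajectory.duration (T := T) ⟨s, x⟩) := h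
      rw [Trajectory.stateAt, dif_neg h']
      rfl
    simp only [this]
    exact measurable_const

lemma measurable_gospaOne_stateAt {db : E → E → ℝ} (hdb_meas : Measurable (Function.uncurry db))
    (c p ρ : ℝ) (k : ℕ) :
    Measurable fun z : Trajectory T E × Trajectory T E =>
      gospaOne db c p ρ (z.1.stateAt k) (z.2.stateAt k) := by
  classical
  rcases isEmpty_or_nonempty (Trajectory T E) with h | ⟨⟨X₀⟩⟩
  · exact measurable_of_empty _
  -- The default state needed for `getD` is taken from a trajectory, since `E` itself may be empty.
  let x₀ : E := X₀.2 ⟨0, X₀.1.2.2.2.1⟩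
  have key : ∀ a b : Option E, gospaOne db c p ρ a b =
      if a.isSome then
        if b.isSome then min c (db (a.getD x₀) (b.getD x₀)) else (1 - ρ) ^ (1 / p) * c
      else if b.isSome then ρ ^ (1 / p) * c else 0 := by
    rintro (_ | a) (_ | b) <;> simp [gospaOne]
  simp only [key]
  have m1 : MeasurableSet {z : Trajectory T E × Trajectory T E | (z.1.stateAt k).isSome} :=
    measurable_fst (measurableSet_stateAt_isSome k)
  have m2 : MeasurableSet {z : Trajectory T E × Trajectory T E | (z.2.stateAt k).isSome} :=
    measurable_snd (measurableSet_stateAt_isSome k)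
  refine Measurable.ite m1 (Measurable.ite m2 ?_ measurable_const)
    (Measurable.ite m2 measurable_const measurable_const)
  refine measurable_const.min (hdb_meas.comp (Measurable.prodMk ?_ ?_))
  · exact (measurable_stateAt_getD k x₀).comp measurable_fst
  · exact (measurable_stateAt_getD k x₀).comp measurable_snd

lemma measurable_gospaOne_stateAt_none (db : E → E → ℝ) (c p ρ : ℝ) (k : ℕ) :
    Measurable fun X : Trajectory T E => gospaOne db c p ρ (X.stateAt k) none := by
  have key : ∀ a : Option E, gospaOne db c p ρ a none =
      if a.isSome then (1 - ρ) ^ (1 / p) * c else 0 := by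
    rintro (_ | a) <;> simp [gospaOne]
  simp only [key]
  exact Measurable.ite (measurableSet_stateAt_isSome k) measurable_const measurable_const

lemma measurable_gospaOne_none_stateAt (db : E → E → ℝ) (c p ρ : ℝ) (k : ℕ) :
    Measurable fun X : Trajectory T E => gospaOne db c p ρ none (X.stateAt k) := by
  have key : ∀ a : Option E, gospaOne db c p ρ none a =
      if a.isSome then ρ ^ (1 / p) * c else 0 := by
    rintro (_ | a) <;> simp [gospaOne]
  simp only [key]
  exact Measurable.ite (measurableSet_stateAt_isSome k) measurable_const measurable_const

lemma measurable_familyStepCost {ι κ Ω : Type*} [Fintype ι] [Fintype κ] [MeasurableSpace Ω]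
    {db : E → E → ℝ} (hdb_meas : Measurable (Function.uncurry db)) (c p ρ : ℝ) (k : ℕ)
    {x : Ω → ι → Trajectory T E} {y : Ω → κ → Trajectory T E} (hx : ∀ i, Measurable fun ω => x ω i)
    (hy : ∀ j, Measurable fun ω => y ω j) (f : ι ≃. κ) :
    Measurable fun ω => familyStepCost (gospaOne db c p ρ) p (fun i => (x ω i).stateAt k)
      (fun j => (y ω j).stateAt k) f := by
  unfold familyStepCost
  simp only [pairingCost_eq_sum_left, Option.bind_some, Option.bind_none]
  refine (Finset.measurable_fun_sum _ fun i _ => ?_).add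
    (Finset.measurable_fun_sum _ fun j _ => ?_)
  · rcases f i with _ | j
    · exact ((measurable_gospaOne_stateAt_none db c p ρ k).comp (hx i)).pow_const p
    · exact ((measurable_gospaOne_stateAt hdb_meas c p ρ k).comp
        ((hx i).prodMk (hy j))).pow_const p
  · split_ifs
    · exact ((measurable_gospaOne_none_stateAt db c p ρ k).comp (hy j)).pow_const p
    · exact measurable_const

lemma measurable_tgospa_comp {Ω : Type*} [MeasurableSpace Ω] {db : E → E → ℝ}
    (hdb_meas : Measurable (Function.uncurry db)) {c p ρ : ℝ} (hc : 0 < c) (hp : 1 ≤ p)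
    (hρ : 0 < ρ) (hρ' : ρ < 1) (γ : ℝ) {X Y : Ω → Finset (Trajectory T E)}
    (hX : Measurable[_, finiteSetSigma (Trajectory T E)] X)
    (hY : Measurable[_, finiteSetSigma (Trajectory T E)] Y) :
    Measurable fun ω => tgospa db c p γ ρ (X ω) (Y ω) := by
  refine measurable_comp_finiteSetSigma (fun n m => ?_) hX hY
  have key := fun (z : {x : Fin n → Trajectory T E // Function.Injective x} ×
      {x : Fin m → Trajectory T E // Function.Injective x}) =>
    tgospa_eq_iInf_familyCost (db := db) hc hp hρ hρ' γ (equivFinsetOfTuple z.1)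
      (equivFinsetOfTuple z.2)
  simp only [key, equivFinsetOfTuple_apply]
  refine Measurable.iInf fun f => Measurable.pow_const ?_ _
  -- For a fixed sequence of matchings of `Fin n` and `Fin m` the switch penalty does not depend on
  -- the tuples.
  refine (Finset.measurable_fun_sum _ fun k _ => ?_).add measurable_const
  refine measurable_familyStepCost hdb_meas c p ρ _ (fun i => ?_) (fun j => ?_) (f k)
  · exact (measurable_pi_apply i).comp (measurable_subtype_coe.comp measurable_fst)
  · exact (measurable_pi_apply j).comp (measurable_subtype_coe.comp measurable_snd)

end TGOSPAMeasurability

/-! ### Integrability and Minkowski's inequality for random finite sets -/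

section RandomFiniteSets

variable {Ω : Type*} [MeasurableSpace Ω] {P : Measure Ω} {T : ℕ} {E : Type*} [MeasurableSpace E]
  {db : E → E → ℝ} {c p γ ρ p' : ℝ}

/-- The crude bound by twice the maximum is valid for every `r ≥ 0`; the exponent `p' / p` may be
below `1`, where convexity is not available. -/
lemma Real.add_rpow_le_two_rpow_mul {a b r : ℝ} (ha : 0 ≤ a) (hb : 0 ≤ b) (hr : 0 ≤ r) :
    (a + b) ^ r ≤ 2 ^ r * (a ^ r + b ^ r) := by
  have h1 : a + b ≤ 2 * max a b := by linarith [le_max_left a b, le_max_right a b]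
  refine (Real.rpow_le_rpow (by positivity) h1 hr).trans ?_
  rw [Real.mul_rpow (by norm_num) (by positivity)]
  refine mul_le_mul_of_nonneg_left ?_ (by positivity)
  have := Real.rpow_nonneg ha r
  have := Real.rpow_nonneg hb r
  rcases max_choice a b with h | h <;> rw [h] <;> linarith

lemma integrable_tgospa_rpow (hdb : IsQMetric db) (hdb_meas : Measurable (Function.uncurry db))
    (hc : 0 < c) (hp : 1 ≤ p) (hγ : 0 < γ) (hρ : 0 < ρ) (hρ' : ρ < 1) (hp' : 1 ≤ p')
    (X Y : TrajectoryRFS P T E (p' / p)) :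
    Integrable (fun ω => tgospa db c p γ ρ (X.toFun ω) (Y.toFun ω) ^ p') P := by
  have hr : 0 ≤ p' / p := by positivity
  refine Integrable.mono' (((X.moment.add Y.moment).const_mul (2 ^ (p' / p))).const_mul
    ((T * c ^ p) ^ (p' / p))) ?_ (Filter.Eventually.of_forall fun ω => ?_)
  · exact ((measurable_tgospa_comp hdb_meas hc hp hρ hρ' γ X.measurable
      Y.measurable).pow_const p').aestronglyMeasurable
  · have h0 := tgospa_nonneg hdb hc hp hγ hρ hρ' (X.toFun ω) (Y.toFun ω)
    rw [Real.norm_of_nonneg (Real.rpow_nonneg h0 _)]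
    have hTc : 0 ≤ (T : ℝ) * c ^ p := by positivity
    calc tgospa db c p γ ρ (X.toFun ω) (Y.toFun ω) ^ p'
        ≤ ((T * c ^ p * (((X.toFun ω).card : ℝ) + (Y.toFun ω).card)) ^ (1 / p)) ^ p' :=
          Real.rpow_le_rpow h0 (tgospa_le_card hc hp hρ hρ' _ _) (by linarith)
      _ = (T * c ^ p) ^ (p' / p)
          * (((X.toFun ω).card : ℝ) + (Y.toFun ω).card) ^ (p' / p) := by
          rw [← Real.rpow_mul (by positivity), one_div_mul_eq_div,
            Real.mul_rpow hTc (by positivity)]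
      _ ≤ _ := mul_le_mul_of_nonneg_left
          (Real.add_rpow_le_two_rpow_mul (by positivity) (by positivity) hr) (by positivity)

/-- Minkowski's inequality for non-negative real functions. -/
lemma integral_rpow_le_add {f g h : Ω → ℝ} (hp' : 1 ≤ p') (hf0 : ∀ ω, 0 ≤ f ω)
    (hg0 : ∀ ω, 0 ≤ g ω) (hh0 : ∀ ω, 0 ≤ h ω) (hg : AEMeasurable g P)
    (hh : AEMeasurable h P) (hfi : Integrable (fun ω => f ω ^ p') P)
    (hgi : Integrable (fun ω => g ω ^ p') P)
    (hhi : Integrable (fun ω => h ω ^ p') P) (hle : ∀ ω, f ω ≤ g ω + h ω) :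
    (∫ ω, f ω ^ p' ∂P) ^ (1 / p')
      ≤ (∫ ω, g ω ^ p' ∂P) ^ (1 / p') + (∫ ω, h ω ^ p' ∂P) ^ (1 / p') := by
  have hp0 : 0 < p' := by linarith
  -- Integrability identifies the real norms with extended non-negative ones, where Minkowski's
  -- inequality is applied.
  have conv : ∀ u : Ω → ℝ, (∀ ω, 0 ≤ u ω) → Integrable (fun ω => u ω ^ p') P →
      ENNReal.ofReal ((∫ ω, u ω ^ p' ∂P) ^ (1 / p'))
        = (∫⁻ ω, ENNReal.ofReal (u ω) ^ p' ∂P) ^ (1 / p') := fun u hu hui => by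
    have hnn : ∀ ω, 0 ≤ u ω ^ p' := fun ω => Real.rpow_nonneg (hu ω) _
    rw [← ENNReal.ofReal_rpow_of_nonneg (integral_nonneg hnn) (by positivity),
      ofReal_integral_eq_lintegral_ofReal hui (Filter.Eventually.of_forall hnn)]
    simp only [ENNReal.ofReal_rpow_of_nonneg (hu _) hp0.le]
  have nn : ∀ u : Ω → ℝ, (∀ ω, 0 ≤ u ω) → 0 ≤ (∫ ω, u ω ^ p' ∂P) ^ (1 / p') := fun u hu =>
    Real.rpow_nonneg (integral_nonneg fun ω => Real.rpow_nonneg (hu ω) _) _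
  rw [← ENNReal.ofReal_le_ofReal_iff (add_nonneg (nn g hg0) (nn h hh0)),
    ENNReal.ofReal_add (nn g hg0) (nn h hh0), conv f hf0 hfi, conv g hg0 hgi, conv h hh0 hhi]
  refine le_trans ?_ (ENNReal.lintegral_Lp_add_le hg.ennreal_ofReal hh.ennreal_ofReal hp')
  refine ENNReal.rpow_le_rpow (lintegral_mono fun ω => ENNReal.rpow_le_rpow ?_ hp0.le)
    (by positivity)
  rw [Pi.add_apply, ← ENNReal.ofReal_add (hg0 ω) (hh0 ω)]
  exact ENNReal.ofReal_le_ofReal (hle ω)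

end RandomFiniteSets

end

/-! ### The q-metric on random finite sets -/

theorem lemma10 {Ω : Type*} [MeasurableSpace Ω] (P : Measure Ω) [IsProbabilityMeasure P]
    (T : ℕ) {E : Type*} [MeasurableSpace E]
    (db : E → E → ℝ) (hdb : IsQMetric db) (hdb_meas : Measurable (Function.uncurry db))
    (c p γ ρ p' : ℝ) (hc : 0 < c) (hp : 1 ≤ p) (hγ : 0 < γ) (hρ : 0 < ρ) (hρ' : ρ < 1)
    (hp' : 1 ≤ p') :
    (∀ X Y : TrajectoryRFS P T E (p' / p),
        Integrable (fun ω => tgospa db c p γ ρ (X.toFun ω) (Y.toFun ω) ^ p') P) ∧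
      IsQMetric (rfsQDist db c p γ ρ p' :
        RFSSpace P T E (p' / p) → RFSSpace P T E (p' / p) → ℝ) := by
  have hint := integrable_tgospa_rpow (P := P) (T := T) hdb hdb_meas hc hp hγ hρ hρ' hp'
  have hnn := tgospa_nonneg (T := T) hdb hc hp hγ hρ hρ'
  have hp0 : p' ≠ 0 := by linarith
  have hpow : ∀ X Y : TrajectoryRFS P T E (p' / p), ∀ ω,
      0 ≤ tgospa db c p γ ρ (X.toFun ω) (Y.toFun ω) ^ p' := fun X Y ω =>
    Real.rpow_nonneg (hnn _ _) _
  have hmeas : ∀ X Y : TrajectoryRFS P T E (p' / p),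
      Measurable fun ω => tgospa db c p γ ρ (X.toFun ω) (Y.toFun ω) := fun X Y =>
    measurable_tgospa_comp hdb_meas hc hp hρ hρ' γ X.measurable Y.measurable
  refine ⟨hint, ⟨?_, ?_, ?_⟩⟩
  · intro X Y
    induction X, Y using Quotient.inductionOn₂ with | _ X Y
    exact Real.rpow_nonneg (integral_nonneg (hpow X Y)) _
  · intro X Y
    induction X, Y using Quotient.inductionOn₂ with | _ X Y
    have h1 : rfsDist db c p γ ρ p' X Y = 0 ↔ X.toFun =ᵐ[P] Y.toFun := by
      unfold rfsDist
      rw [Real.rpow_eq_zero (integral_nonneg (hpow X Y)) (by positivity),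
        integral_eq_zero_iff_of_nonneg (hpow X Y) (hint X Y)]
      refine Filter.eventually_congr (Filter.Eventually.of_forall fun ω => ?_)
      rw [Pi.zero_apply, Real.rpow_eq_zero (hnn _ _) hp0,
        tgospa_eq_zero_iff hdb hc hp hγ hρ hρ']
    exact h1.trans (Quotient.eq (r := TrajectoryRFS.setoid P T E (p' / p))).symm
  · intro X Y Z
    induction X, Y using Quotient.inductionOn₂ with | _ X Y
    induction Z using Quotient.inductionOn with | _ Z
    exact integral_rpow_le_add hp' (fun _ => hnn _ _) (fun _ => hnn _ _) (fun _ => hnn _ _)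
      (hmeas X Z).aemeasurable (hmeas Z Y).aemeasurable (hint X Y) (hint X Z) (hint Z Y)
      fun _ => tgospa_triangle hdb hc hp hγ hρ hρ' _ _ _
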